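/- Conventions. A coherence space $X$ is a countable set of tokens with a reflexive symmetric relation (coherence). A clique is a set of pairwise coherent tokens; an anti-clique is a set of tokens no two distinct members of which are coherent. For a set $\mathcal A$ of cliques, $\mathcal A^{\perp}$ is the set of anti-cliques that meet every member of $\mathcal A$ (necessarily in a single token); $\perp$ of a set of anti-cliques is the dual notion. A totality on $X$ is a set $\mathcal T_X$ of cliques with $\mathcal T_X=\mathcal T_X^{\perp\perp}$. For $a\in\mathcal T_X$ let $a^\circ=\bigcap\{b\in\mathcal T_X: b\subseteq a\}$, and let $\mathcal T_X^\circ=\{a\in\mathcal T_X: a^\circ=a\}$ be the set of strict total cliques; $(\mathcal T_X^\perp)^\circ$ is defined likewise. A map of cliques is stable if it is Scott-continuous and preserves intersections of coherent cliques, and linear if it preserves disjoint unions of cliques. $!X$ is the coherence space whose tokens are the finite cliques of $X$, two being coherent when their union is a clique; $!a$ is the set of finite subsets of $a$; $\mathcal T_{!X}=\{!a : a\in\mathcal T_X\}^{\perp\perp}$. A linear map is total if it sends total cliques to total cliques; a stable map $X\to Y$ is total if the linear map $!X\to Y$ with the same trace (set of minimal pairs) is total. $\mathbf{Lin}_{\mathrm{Tot}}$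 and $\mathbf{Stab}_{\mathrm{Tot}}$ are the categories of coherence spaces with totality and total linear, respectively total stable, maps. $\mathbf{Tych}$ is the category of Tychonoff spaces and continuous maps, $\mathbf{Unif}$ that of Hausdorff uniform spaces and uniformly continuous maps. Adjunctions. $K:\mathbf{Stab}_{\mathrm{Tot}}\to\mathbf{Lin}_{\mathrm{Tot}}$ sends $X$ to $!X$ and a total stable map $f:X\to Y$ to the linear map $!X\to{!Y}$ determined by $!a\mapsto{!f(a)}$; $L:\mathbf{Lin}_{\mathrm{Tot}}\to\mathbf{Stab}_{\mathrm{Tot}}$ is the identity on objects and regards a linear map as a stable map. $K\dashv L$, with unit $\eta_{\mathrm{coh}}: a\mapsto{!a}$ and counit the dereliction $\epsilon_{\mathrm{coh}}:\alpha\mapsto\{y:\{y\}\in\alpha\}$ (so $!a\mapsto a$). $F:\mathbf{Tych}\to\mathbf{Unif}$ equips a Tychonoff space with the finest uniformity compatible with its topology, and $G:\mathbf{Unif}\to\mathbf{Tych}$ equips a uniform space with its uniform topology; $F\dashv G$, with unit $\eta_{\mathrm{unif}}$ and counit $\epsilon_{\mathrm{unif}}$ the identity on points. Functors. $I:\mathbf{Stab}_{\mathrm{Tot}}\to\mathbf{Tych}$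 sends $X$ to $\mathcal T_X^\circ$ with the topology induced by the Scott topology on cliques (generated by the sets $\{b : a\subseteq b\}$, $a$ a finite clique). $J:\mathbf{Lin}_{\mathrm{Tot}}\to\mathbf{Unif}$ sends $X$ to $\mathcal T_X^\circ$ with the bounded uniformity, which has as a sub-basis the covers $\{\{a\in\mathcal T_X^\circ : x\in a\} : x\in\mathfrak c\}$, $\mathfrak c\in(\mathcal T_X^\perp)^\circ$. Both send a map $f:X\to Y$ to $a\mapsto f(a)^\circ$. Theorem. $(I,J)$ is a pseudo-map of adjunctions from $K\dashv L$ to $F\dashv G$: there are natural isomorphisms $\varphi: JK\cong FI$ and $\psi: IL\cong GJ$ such that for every $X\in\mathbf{Stab}_{\mathrm{Tot}}$ $$G(\varphi_X)\circ\psi_{KX}\circ I\big((\eta_{\mathrm{coh}})_X\big)=(\eta_{\mathrm{unif}})_{IX}: IX\to GFIX,$$ and for every $Y\in\mathbf{Lin}_{\mathrm{Tot}}$ $$(\epsilon_{\mathrm{unif}})_{JY}\circ F(\psi_Y)\circ\varphi_{LY}=J\big((\epsilon_{\mathrm{coh}})_Y\big): JKLY\to JY.$$ -/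

import Mathlib

open CategoryTheory

universe u

namespace CohUnif

/-! ### Coherence spaces -/

/-- A coherence space: a countable set of tokens with a reflexive symmetric relation. -/
structure CohSpace : Type (u + 1) where
  Token : Type u
  countable_token : Countable Token
  coh : Token → Token → Prop
  coh_refl : ∀ x, coh x x
  coh_symm : ∀ x y, coh x y → coh y x

namespace CohSpace

/-- Strict coherence. -/
def scoh (X : CohSpace.{u}) (x y : X.Token) : Prop := X.coh x y ∧ x ≠ y

/-- Cliques: sets of pairwise coherent tokens. -/
def IsClique (X : CohSpace.{u}) (a : Set X.Token) : Prop := ∀ x ∈ a, ∀ y ∈ a, X.coh x y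

/-- The dual space, whose coherence is the incoherence `¬ (x scoh y)` of `X`; its cliques are the
anti-cliques of `X`. -/
abbrev dual (X : CohSpace.{u}) : CohSpace.{u} where
  Token := X.Token
  countable_token := X.countable_token
  coh x y := ¬ X.scoh x y
  coh_refl _ h := h.2 rfl
  coh_symm _ _ h h' := h ⟨X.coh_symm _ _ h'.1, h'.2.symm⟩

/-- The poset of cliques of `X`, ordered by inclusion. -/
abbrev Clique (X : CohSpace.{u}) : Type u := {a : Set X.Token // X.IsClique a}

/-- Coherence of cliques: `a ∪ b` is a clique. -/
def Compatible (X : CohSpace.{u}) (a b : X.Clique) : Prop := X.IsClique (a.1 ∪ b.1)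

/-- The intersection of two cliques. -/
def inter {X : CohSpace.{u}} (a b : X.Clique) : X.Clique :=
  ⟨a.1 ∩ b.1, fun x hx y hy => a.2 x hx.1 y hy.1⟩

/-- The Scott topology on the cliques, generated by the upper sets of the finite cliques. -/
@[reducible] def scott (X : CohSpace.{u}) : TopologicalSpace X.Clique :=
  TopologicalSpace.generateFrom {U | ∃ a : X.Clique, a.1.Finite ∧ U = {b | a ≤ b}}

/-- `!X`: tokens are the finite cliques of `X`, coherent when their union is a clique. -/
abbrev bang (X : CohSpace.{u}) : CohSpace.{u} where
  Token := {a : Finset X.Token // X.IsClique (a : Set X.Token)}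
  countable_token := by
    have := X.countable_token
    infer_instance
  coh a b := X.IsClique ((a.1 : Set X.Token) ∪ (b.1 : Set X.Token))
  coh_refl a := by simpa using a.2
  coh_symm a b h := by rwa [Set.union_comm]

/-- `!a`: the set of all finite subcliques of `a`. -/
def bangSet (X : CohSpace.{u}) (a : Set X.Token) : Set X.bang.Token :=
  {a₀ | (a₀.1 : Set X.Token) ⊆ a}

theorem bangSet_isClique (X : CohSpace.{u}) {a : Set X.Token} (ha : X.IsClique a) :
    X.bang.IsClique (X.bangSet a) := by
  intro b hb c hc x hx y hy
  exact ha x (hx.elim (fun h => hb h) (fun h => hc h)) y (hy.elim (fun h => hb h) (fun h => hc h))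

/-- `a ↦ !a` on cliques. -/
def bangClique {X : CohSpace.{u}} (a : X.Clique) : X.bang.Clique :=
  ⟨X.bangSet a.1, X.bangSet_isClique a.2⟩

/-- `A^⊥`: the anti-cliques `c` of `X` with `a ∩ c ≠ ∅` (equivalently, `a ∩ c` a singleton) for
every `a ∈ A`. -/
def orth (X : CohSpace.{u}) (A : Set (Set X.Token)) : Set (Set X.Token) :=
  {c | X.dual.IsClique c ∧ ∀ a ∈ A, (a ∩ c).Nonempty}

theorem isClique_singleton (X : CohSpace.{u}) (x : X.Token) : X.IsClique {x} := by
  rintro y rfl z rfl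
  exact X.coh_refl _

/-- The singleton clique. -/
def single {X : CohSpace.{u}} (x : X.Token) : X.Clique := ⟨{x}, X.isClique_singleton x⟩

theorem IsClique.mono {X : CohSpace.{u}} {a b : Set X.Token} (hb : X.IsClique b) (h : a ⊆ b) :
    X.IsClique a := fun x hx y hy => hb x (h hx) y (h hy)

theorem dual_dual_isClique (X : CohSpace.{u}) (a : Set X.Token) :
    X.dual.dual.IsClique a ↔ X.IsClique a := by
  constructor
  · intro h x hx y hy
    by_contra hc
    refine h x hx y hy ⟨fun h' => hc h'.1, ?_⟩
    rintro rfl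
    exact hc (X.coh_refl _)
  · intro h x hx y hy h'
    exact h'.1 ⟨h x hx y hy, h'.2⟩

/-- A clique and an anti-clique share at most one token. -/
theorem eq_of_mem_clique_anticlique {X : CohSpace.{u}} {a c : Set X.Token} (ha : X.IsClique a)
    (hc : X.dual.IsClique c) {x y : X.Token} (hx : x ∈ a) (hy : y ∈ a) (hx' : x ∈ c)
    (hy' : y ∈ c) : x = y := by
  by_contra h
  exact hc x hx' y hy' ⟨ha x hx y hy, h⟩

theorem subset_biorth (X : CohSpace.{u}) {A : Set (Set X.Token)} (hA : ∀ a ∈ A, X.IsClique a) :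
    A ⊆ X.dual.orth (X.orth A) := by
  intro a ha
  refine ⟨(X.dual_dual_isClique a).2 (hA a ha), fun c hc => ?_⟩
  have := hc.2 a ha
  rwa [Set.inter_comm] at this

theorem biorth_biorth (X : CohSpace.{u}) {A : Set (Set X.Token)} (hA : ∀ a ∈ A, X.IsClique a) :
    X.dual.orth (X.orth (X.dual.orth (X.orth A))) = X.dual.orth (X.orth A) := by
  have h : X.orth (X.dual.orth (X.orth A)) = X.orth A := by
    ext c
    constructor
    · exact fun hc => ⟨hc.1, fun a ha => hc.2 a (X.subset_biorth hA ha)⟩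
    · refine fun hc => ⟨hc.1, fun a ha => ?_⟩
      have := ha.2 c hc
      rwa [Set.inter_comm] at this
  rw [h]

end CohSpace

open CohSpace

/-! ### Stable and linear maps -/

/-- Stable maps: Scott-continuous and preserving intersections of coherent cliques. -/
def IsStable {X Y : CohSpace.{u}} (F : X.Clique → Y.Clique) : Prop :=
  ScottContinuous F ∧ ∀ a b, X.Compatible a b → F (inter a b) = inter (F a) (F b)

/-- `a` is the disjoint union of the family `s`. -/
def IsDisjointUnion {X : CohSpace.{u}} {ι : Type u} (a : X.Clique) (s : ι → X.Clique) : Prop :=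
  a.1 = ⋃ i, (s i).1 ∧ ∀ i j, i ≠ j → Disjoint (s i).1 (s j).1

/-- Linear maps: preserving all disjoint unions of cliques. -/
def IsLinear {X Y : CohSpace.{u}} (F : X.Clique → Y.Clique) : Prop :=
  ∀ (ι : Type u) (a : X.Clique) (s : ι → X.Clique),
    IsDisjointUnion a s → IsDisjointUnion (F a) (fun i => F (s i))

/-- The trace of `F`: the pairs `(a, y)` with `a` a finite clique minimal such that `y ∈ F a`. -/
def trace {X Y : CohSpace.{u}} (F : X.Clique → Y.Clique) : Set (X.bang.Token × Y.Token) :=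
  {p | p.2 ∈ (F ⟨p.1.1, p.1.2⟩).1 ∧
    ∀ a' : X.Clique, a'.1 ⊂ (p.1.1 : Set X.Token) → p.2 ∉ (F a').1}

theorem mem_of_isLUB {X : CohSpace.{u}} {d : Set X.Clique} {a : X.Clique} (h : IsLUB d a)
    {x : X.Token} (hx : x ∈ a.1) : ∃ b ∈ d, x ∈ b.1 := by
  have hsub : (⋃ b ∈ d, b.1) ⊆ a.1 := by
    simp only [Set.iUnion_subset_iff]
    exact fun b hb => h.1 hb
  have h2 : a ≤ ⟨⋃ b ∈ d, b.1, a.2.mono hsub⟩ :=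
    h.2 fun b hb => Set.subset_biUnion_of_mem (u := fun b : X.Clique => b.1) hb
  simpa using h2 hx

theorem isLinear_iff {X Y : CohSpace.{u}} (F : X.Clique → Y.Clique) :
    IsLinear F ↔ (∀ a y, y ∈ (F a).1 ↔ ∃ x ∈ a.1, y ∈ (F (single x)).1) ∧
      ∀ (a : X.Clique) (y : Y.Token), ∀ x ∈ a.1, ∀ x' ∈ a.1,
        y ∈ (F (single x)).1 → y ∈ (F (single x')).1 → x = x' := by
  constructor
  · intro hF
    have key : ∀ a : X.Clique, IsDisjointUnion (F a) (fun x : a.1 => F (single x.1)) := by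
      intro a
      refine hF a.1 a (fun x => single x.1) ⟨?_, ?_⟩
      · ext x
        simp [single]
      · intro i j hij
        simpa [single, Subtype.ext_iff] using fun h => hij (Subtype.ext h)
    refine ⟨fun a y => ?_, fun a y x hx x' hx' hy hy' => ?_⟩
    · rw [(key a).1]
      simp
    · by_contra hne
      exact Set.disjoint_left.1 ((key a).2 ⟨x, hx⟩ ⟨x', hx'⟩ (by simpa using hne)) hy hy'
  · rintro ⟨h1, h2⟩ ι a s ⟨hs, hd⟩
    have hmem : ∀ x, x ∈ a.1 ↔ ∃ i, x ∈ (s i).1 := by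
      intro x
      rw [hs]
      simp
    refine ⟨?_, fun i j hij => Set.disjoint_left.2 fun y hy hy' => ?_⟩
    · ext y
      rw [Set.mem_iUnion, h1]
      constructor
      · rintro ⟨x, hx, hy⟩
        obtain ⟨i, hi⟩ := (hmem x).1 hx
        exact ⟨i, (h1 _ _).2 ⟨x, hi, hy⟩⟩
      · rintro ⟨i, hy⟩
        obtain ⟨x, hx, hy⟩ := (h1 _ _).1 hy
        exact ⟨x, (hmem x).2 ⟨i, hx⟩, hy⟩
    · obtain ⟨x, hx, hxy⟩ := (h1 _ _).1 hy
      obtain ⟨x', hx', hxy'⟩ := (h1 _ _).1 hy'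
      obtain rfl := h2 a y x ((hmem x).2 ⟨i, hx⟩) x' ((hmem x').2 ⟨j, hx'⟩) hxy hxy'
      exact Set.disjoint_left.1 (hd i j hij) hx hx'

theorem IsLinear.monotone {X Y : CohSpace.{u}} {F : X.Clique → Y.Clique} (hF : IsLinear F) :
    Monotone F := by
  intro a b hab y hy
  obtain ⟨x, hx, hy⟩ := (((isLinear_iff F).1 hF).1 a y).1 hy
  exact (((isLinear_iff F).1 hF).1 b y).2 ⟨x, hab hx, hy⟩

theorem IsLinear.isStable {X Y : CohSpace.{u}} {F : X.Clique → Y.Clique} (hF : IsLinear F) :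
    IsStable F := by
  obtain ⟨h1, h2⟩ := (isLinear_iff F).1 hF
  refine ⟨fun d _ _ a ha => ⟨?_, ?_⟩, fun a b hab => Subtype.ext (Set.ext fun y => ?_)⟩
  · rintro _ ⟨b, hb, rfl⟩
    exact hF.monotone (ha.1 hb)
  · intro c hc y hy
    obtain ⟨x, hx, hxy⟩ := (h1 _ _).1 hy
    obtain ⟨b, hb, hxb⟩ := mem_of_isLUB ha hx
    exact hc ⟨b, hb, rfl⟩ ((h1 _ _).2 ⟨x, hxb, hxy⟩)
  · constructor
    · intro hy
      obtain ⟨x, hx, hxy⟩ := (h1 _ _).1 hy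
      exact ⟨(h1 _ _).2 ⟨x, hx.1, hxy⟩, (h1 _ _).2 ⟨x, hx.2, hxy⟩⟩
    · rintro ⟨hy, hy'⟩
      obtain ⟨x, hx, hxy⟩ := (h1 _ _).1 hy
      obtain ⟨x', hx', hxy'⟩ := (h1 _ _).1 hy'
      obtain rfl := h2 ⟨_, hab⟩ y x (Or.inl hx) x' (Or.inr hx') hxy hxy'
      exact (h1 _ _).2 ⟨x, ⟨hx, hx'⟩, hxy⟩

theorem IsStable.monotone {X Y : CohSpace.{u}} {F : X.Clique → Y.Clique} (hF : IsStable F) :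
    Monotone F := hF.1.monotone

theorem isLinear_id (X : CohSpace.{u}) : IsLinear (fun a : X.Clique => a) := fun _ _ _ h => h

theorem IsLinear.comp {X Y Z : CohSpace.{u}} {F : X.Clique → Y.Clique} {G : Y.Clique → Z.Clique}
    (hG : IsLinear G) (hF : IsLinear F) : IsLinear (fun a => G (F a)) :=
  fun ι a s h => hG ι _ _ (hF ι a s h)

theorem IsStable.comp {X Y Z : CohSpace.{u}} {F : X.Clique → Y.Clique} {G : Y.Clique → Z.Clique}
    (hG : IsStable G) (hF : IsStable F) : IsStable (fun a => G (F a)) := by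
  refine ⟨fun d hd hdir a ha => ?_, fun a b hab => ?_⟩
  · have := hG.1 (hd.image F) (hdir.mono_comp hF.monotone) (hF.1 hd hdir ha)
    rwa [Set.image_image] at this
  · have : Y.Compatible (F a) (F b) := by
      refine (F ⟨_, hab⟩).2.mono (Set.union_subset ?_ ?_)
      · exact hF.monotone (fun x hx => Or.inl hx : a.1 ⊆ _)
      · exact hF.monotone (fun x hx => Or.inr hx : b.1 ⊆ _)
    show G (F (inter a b)) = _
    rw [hF.2 a b hab, hG.2 _ _ this]

theorem isStable_bangClique (X : CohSpace.{u}) :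
    IsStable (fun a : X.Clique => (bangClique a : X.bang.Clique)) := by
  refine ⟨fun d hd hdir a ha => ⟨?_, ?_⟩, fun a b _ => Subtype.ext (Set.ext fun y => ?_)⟩
  · rintro _ ⟨b, hb, rfl⟩ x hx
    exact Set.Subset.trans hx (ha.1 hb)
  · intro c hc x hx
    have : ∀ t : Finset X.Token, (t : Set X.Token) ⊆ a.1 → ∃ b ∈ d, (t : Set X.Token) ⊆ b.1 := by
      intro t hx'
      classical
      induction t using Finset.induction_on with
      | empty =>
        obtain ⟨b, hb⟩ := hd
        exact ⟨b, hb, by simp⟩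
      | insert z s _ ih =>
        rw [Finset.coe_insert, Set.insert_subset_iff] at hx'
        obtain ⟨b, hb, hsb⟩ := ih hx'.2
        obtain ⟨b', hb', hzb'⟩ := mem_of_isLUB ha hx'.1
        obtain ⟨e, he, hbe, hbe'⟩ := hdir b hb b' hb'
        refine ⟨e, he, ?_⟩
        rw [Finset.coe_insert, Set.insert_subset_iff]
        exact ⟨hbe' hzb', hsb.trans hbe⟩
    obtain ⟨b, hb, hxb⟩ := this x.1 hx
    exact hc ⟨b, hb, rfl⟩ hxb
  · exact Set.subset_inter_iff

theorem exists_trace {X Y : CohSpace.{u}} {F : X.Clique → Y.Clique} (hF : IsStable F)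
    {a : X.Clique} {y : Y.Token} (hy : y ∈ (F a).1) :
    ∃ a₀ : X.bang.Token, (a₀.1 : Set X.Token) ⊆ a.1 ∧ (a₀, y) ∈ trace F := by
  classical
  let d : Set X.Clique := {b | b.1.Finite ∧ b ≤ a}
  have hne : d.Nonempty := ⟨⟨∅, fun x hx => hx.elim⟩, Set.finite_empty, fun x hx => hx.elim⟩
  have hdir : DirectedOn (· ≤ ·) d := by
    intro b hb c hc
    have hbc : b.1 ∪ c.1 ⊆ a.1 := Set.union_subset hb.2 hc.2
    exact ⟨⟨b.1 ∪ c.1, a.2.mono hbc⟩, ⟨hb.1.union hc.1, hbc⟩,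
      fun x hx => Or.inl hx, fun x hx => Or.inr hx⟩
  have hlub : IsLUB d a := by
    refine ⟨fun b hb => hb.2, fun c hc x hx => ?_⟩
    have : single x ∈ d := ⟨Set.finite_singleton x, by
      intro z hz
      obtain rfl : z = x := hz
      exact hx⟩
    exact hc this (Set.mem_singleton x)
  obtain ⟨_, ⟨b, hb, rfl⟩, hyb⟩ := mem_of_isLUB (hF.1 hne hdir hlub) hy
  have key : ∀ s : Finset X.Token, ∀ hs : (s : Set X.Token) ⊆ a.1,
      y ∈ (F ⟨s, a.2.mono hs⟩).1 →
      ∃ a₀ : X.bang.Token, (a₀.1 : Set X.Token) ⊆ a.1 ∧ (a₀, y) ∈ trace F := by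
    intro s
    induction s using Finset.strongInduction with
    | H s ih =>
      intro hs hys
      by_cases h : ∃ a' : X.Clique, a'.1 ⊂ (s : Set X.Token) ∧ y ∈ (F a').1
      · obtain ⟨a', ha', hya'⟩ := h
        have hfin : a'.1.Finite := s.finite_toSet.subset ha'.1
        refine ih hfin.toFinset ?_ ?_ ?_
        · rw [← Finset.coe_ssubset]
          simpa using ha'
        · simpa using ha'.1.trans hs
        · have : (⟨(hfin.toFinset : Set X.Token), a.2.mono (by simpa using ha'.1.trans hs)⟩ :
              X.Clique) = a' := Subtype.ext (by simp)
          rw [this]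
          exact hya'
      · push Not at h
        exact ⟨⟨s, a.2.mono hs⟩, hs, hys, h⟩
  refine key hb.1.toFinset (by simpa using hb.2) ?_
  have : (⟨(hb.1.toFinset : Set X.Token), a.2.mono (by simpa using hb.2)⟩ : X.Clique) = b :=
    Subtype.ext (by simp)
  rw [this]
  exact hyb

/-- The linear map `!X ⊸ Y` with the same trace as the stable map `F`. -/
def lift {X Y : CohSpace.{u}} (F : X.Clique → Y.Clique) (hF : IsStable F)
    (α : X.bang.Clique) : Y.Clique :=
  ⟨{y | ∃ a ∈ α.1, (a, y) ∈ trace F}, by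
    rintro y ⟨a, ha, hay⟩ y' ⟨a', ha', hay'⟩
    have h := α.2 a ha a' ha'
    refine (F ⟨_, h⟩).2 y ?_ y' ?_
    · exact hF.monotone (show (⟨a.1, a.2⟩ : X.Clique) ≤ ⟨_, h⟩ from fun x hx => Or.inl hx) hay.1
    · exact hF.monotone (show (⟨a'.1, a'.2⟩ : X.Clique) ≤ ⟨_, h⟩ from fun x hx => Or.inr hx)
        hay'.1⟩

theorem trace_unique {X Y : CohSpace.{u}} {F : X.Clique → Y.Clique} (hF : IsStable F)
    {a a' : X.bang.Token} {y : Y.Token} (h : X.bang.coh a a') (ha : (a, y) ∈ trace F)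
    (ha' : (a', y) ∈ trace F) : a = a' := by
  have hi : y ∈ (F (inter ⟨a.1, a.2⟩ ⟨a'.1, a'.2⟩)).1 := by
    rw [hF.2 ⟨a.1, a.2⟩ ⟨a'.1, a'.2⟩ h]
    exact ⟨ha.1, ha'.1⟩
  have h1 : (a.1 : Set X.Token) ∩ a'.1 = a.1 := by
    by_contra hne
    exact ha.2 _ (Set.inter_subset_left.ssubset_of_ne hne) hi
  have h2 : (a.1 : Set X.Token) ∩ a'.1 = a'.1 := by
    by_contra hne
    exact ha'.2 _ (Set.inter_subset_right.ssubset_of_ne hne) hi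
  exact Subtype.ext (Finset.coe_injective (h1.symm.trans h2))

theorem isLinear_lift {X Y : CohSpace.{u}} {F : X.Clique → Y.Clique} (hF : IsStable F) :
    IsLinear (lift F hF) := by
  rw [isLinear_iff]
  have hs : ∀ (a : X.bang.Token) (y : Y.Token),
      y ∈ (lift F hF (single a)).1 ↔ (a, y) ∈ trace F := by
    intro a y
    constructor
    · rintro ⟨b, hb, h⟩
      obtain rfl : b = a := hb
      exact h
    · exact fun h => ⟨a, Set.mem_singleton a, h⟩
  refine ⟨fun α y => ?_, fun α y a ha a' ha' h h' => ?_⟩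
  · exact exists_congr fun a => and_congr_right fun _ => (hs a y).symm
  · exact trace_unique hF (α.2 a ha a' ha') ((hs _ _).1 h) ((hs _ _).1 h')

theorem lift_bangClique {X Y : CohSpace.{u}} {F : X.Clique → Y.Clique} (hF : IsStable F)
    (a : X.Clique) : lift F hF (bangClique a) = F a := by
  refine Subtype.ext (Set.ext fun y => ⟨?_, fun hy => exists_trace hF hy⟩)
  rintro ⟨b, hb, hby⟩
  exact hF.monotone (show (⟨b.1, b.2⟩ : X.Clique) ≤ a from hb) hby.1

/-- A linear map on `!X` is determined by its values on the cliques `!a`. -/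
theorem linear_ext {X Y : CohSpace.{u}} {G H : X.bang.Clique → Y.Clique} (hG : IsLinear G)
    (hH : IsLinear H) (h : ∀ a : X.Clique, G (bangClique a) = H (bangClique a)) : G = H := by
  obtain ⟨g1, g2⟩ := (isLinear_iff G).1 hG
  obtain ⟨h1, h2⟩ := (isLinear_iff H).1 hH
  have key : ∀ (s : Finset X.Token) (hs : X.IsClique (s : Set X.Token)) (y : Y.Token),
      y ∈ (G (single ⟨s, hs⟩)).1 ↔ y ∈ (H (single ⟨s, hs⟩)).1 := by
    intro s
    induction s using Finset.strongInduction with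
    | H s ih =>
      intro hs y
      have hmem : (⟨s, hs⟩ : X.bang.Token) ∈ (bangClique (⟨s, hs⟩ : X.Clique)).1 :=
        Set.Subset.refl _
      constructor
      · intro hy
        have hy1 : y ∈ (G (bangClique (⟨s, hs⟩ : X.Clique))).1 := (g1 _ _).2 ⟨_, hmem, hy⟩
        have hy2 := hy1
        rw [h] at hy2
        obtain ⟨b, hb, hyb⟩ := (h1 _ _).1 hy2
        have hb' : (b.1 : Set X.Token) ⊆ s := hb
        by_cases hbs : b.1 = s
        · obtain rfl : b = ⟨s, hs⟩ := Subtype.ext hbs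
          exact hyb
        · have hss : b.1 ⊂ s := (Finset.coe_subset.1 hb').ssubset_of_ne hbs
          have := (ih b.1 hss b.2 y).2 hyb
          exact absurd (congrArg Subtype.val (g2 _ y _ hb _ hmem this hy)) hbs
      · intro hy
        have hy1 : y ∈ (H (bangClique (⟨s, hs⟩ : X.Clique))).1 := (h1 _ _).2 ⟨_, hmem, hy⟩
        have hy2 := hy1
        rw [← h] at hy2
        obtain ⟨b, hb, hyb⟩ := (g1 _ _).1 hy2
        have hb' : (b.1 : Set X.Token) ⊆ s := hb
        by_cases hbs : b.1 = s
        · obtain rfl : b = ⟨s, hs⟩ := Subtype.ext hbs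
          exact hyb
        · have hss : b.1 ⊂ s := (Finset.coe_subset.1 hb').ssubset_of_ne hbs
          have := (ih b.1 hss b.2 y).1 hyb
          exact absurd (congrArg Subtype.val (h2 _ y _ hb _ hmem this hy)) hbs
  funext α
  refine Subtype.ext (Set.ext fun y => ?_)
  rw [g1, h1]
  exact exists_congr fun a => and_congr_right fun _ => key a.1 a.2 y

/-! ### Totality -/

/-- A coherence space with totality: a set of cliques equal to its bi-orthogonal. -/
structure CohTot : Type (u + 1) extends CohSpace.{u} where
  totality : Set (Set Token)
  biorth : toCohSpace.dual.orth (toCohSpace.orth totality) = totality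

/-- `a° := ⋂ {b ∈ A | b ⊆ a}`. -/
def strictPart {α : Type u} (A : Set (Set α)) (a : Set α) : Set α := ⋂₀ {b | b ∈ A ∧ b ⊆ a}

/-- `A°`: the strict members of `A`. -/
def strict {α : Type u} (A : Set (Set α)) : Set (Set α) := {a | a ∈ A ∧ strictPart A a = a}

namespace CohTot

/-- The co-totality `T^⊥`. -/
def cototality (X : CohTot.{u}) : Set (Set X.Token) := X.orth X.totality

theorem isClique_of_total (X : CohTot.{u}) {a : Set X.Token} (ha : a ∈ X.totality) :
    X.IsClique a := by
  rw [← X.biorth] at ha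
  exact (X.dual_dual_isClique a).1 ha.1

theorem mem_totality_iff (X : CohTot.{u}) (a : Set X.Token) :
    a ∈ X.totality ↔ X.IsClique a ∧ ∀ c ∈ X.cototality, (a ∩ c).Nonempty := by
  conv_lhs => rw [← X.biorth]
  refine and_congr (X.dual_dual_isClique a) (forall₂_congr fun c _ => ?_)
  rw [Set.inter_comm]

/-- The dual `X^⊥` with the totality `T^⊥`. -/
abbrev dualTot (X : CohTot.{u}) : CohTot.{u} where
  toCohSpace := X.toCohSpace.dual
  totality := X.cototality
  biorth := by
    have h : X.toCohSpace.dual.orth X.cototality = X.totality := X.biorth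
    rw [h]
    ext c
    exact and_congr_left fun _ => X.dual.dual_dual_isClique c

theorem mem_strictPart (X : CohTot.{u}) {a : Set X.Token} (ha : a ∈ X.totality) (x : X.Token) :
    x ∈ strictPart X.totality a ↔ x ∈ a ∧ ∃ c ∈ X.cototality, x ∈ c := by
  constructor
  · intro hx
    have hb : {z | z ∈ a ∧ ∃ c ∈ X.cototality, z ∈ c} ∈ X.totality := by
      rw [mem_totality_iff]
      refine ⟨(X.isClique_of_total ha).mono fun z hz => hz.1, fun c hc => ?_⟩
      obtain ⟨z, hza, hzc⟩ := ((X.mem_totality_iff a).1 ha).2 c hc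
      exact ⟨z, ⟨hza, c, hc, hzc⟩, hzc⟩
    exact hx _ ⟨hb, fun z hz => hz.1⟩
  · rintro ⟨hx, c, hc, hxc⟩ b ⟨hb, hba⟩
    obtain ⟨z, hzb, hzc⟩ := ((X.mem_totality_iff b).1 hb).2 c hc
    rwa [eq_of_mem_clique_anticlique (X.isClique_of_total ha) hc.1 hx (hba hzb) hxc hzc]

theorem strictPart_mem (X : CohTot.{u}) {a : Set X.Token} (ha : a ∈ X.totality) :
    strictPart X.totality a ∈ X.totality := by
  rw [mem_totality_iff]
  refine ⟨(X.isClique_of_total ha).mono fun z hz => ((X.mem_strictPart ha z).1 hz).1,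
    fun c hc => ?_⟩
  obtain ⟨z, hza, hzc⟩ := ((X.mem_totality_iff a).1 ha).2 c hc
  exact ⟨z, (X.mem_strictPart ha z).2 ⟨hza, c, hc, hzc⟩, hzc⟩

theorem strictPart_mem_strict (X : CohTot.{u}) {a : Set X.Token} (ha : a ∈ X.totality) :
    strictPart X.totality a ∈ strict X.totality := by
  refine ⟨X.strictPart_mem ha, Set.ext fun x => ?_⟩
  rw [mem_strictPart X (X.strictPart_mem ha), mem_strictPart X ha]
  tauto

theorem strictPart_eq_of_subset (X : CohTot.{u}) {a b : Set X.Token} (ha : a ∈ X.totality)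
    (hb : b ∈ X.totality) (h : a ⊆ b) : strictPart X.totality a = strictPart X.totality b := by
  ext x
  rw [mem_strictPart X ha, mem_strictPart X hb]
  constructor
  · exact fun hx => ⟨h hx.1, hx.2⟩
  · rintro ⟨hx, c, hc, hxc⟩
    obtain ⟨z, hza, hzc⟩ := ((X.mem_totality_iff a).1 ha).2 c hc
    rw [eq_of_mem_clique_anticlique (X.isClique_of_total hb) hc.1 hx (h hza) hxc hzc]
    exact ⟨hza, c, hc, hzc⟩

/-- The strict total cliques `T°`, as a set of points. -/
def Pt (X : CohTot.{u}) : Type u := {a : X.Clique // a.1 ∈ strict X.totality}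

/-- The strict total clique `a°` associated with a total clique `a`. -/
def toPt (X : CohTot.{u}) (a : X.Clique) (ha : a.1 ∈ X.totality) : X.Pt :=
  ⟨⟨strictPart X.totality a.1, X.isClique_of_total (X.strictPart_mem ha)⟩,
    X.strictPart_mem_strict ha⟩

theorem toPt_eq_iff (X : CohTot.{u}) (a : X.Clique) (ha : a.1 ∈ X.totality) (p : X.Pt)
    (h : p.1.1 ⊆ a.1) : X.toPt a ha = p :=
  Subtype.ext (Subtype.ext
    ((X.strictPart_eq_of_subset p.2.1 ha h).symm.trans p.2.2))

/-- The uni-covers: strict members of the co-totality. -/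
def uniCovers (X : CohTot.{u}) : Set (Set X.Token) := strict X.cototality

/-- Every token of a strict total clique lies in a uni-cover. -/
theorem exists_uniCover (X : CohTot.{u}) (p : X.Pt) {x : X.Token} (hx : x ∈ p.1.1) :
    ∃ c ∈ X.uniCovers, x ∈ c := by
  have h : x ∈ strictPart X.totality p.1.1 := by
    rw [p.2.2]
    exact hx
  obtain ⟨_, c, hc, hxc⟩ := (X.mem_strictPart p.2.1 x).1 h
  refine ⟨strictPart X.cototality c, X.dualTot.strictPart_mem_strict hc,
    (X.dualTot.mem_strictPart hc x).2 ⟨hxc, p.1.1, ?_, hx⟩⟩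
  exact X.biorth.ge p.2.1

theorem uniCover_meets (X : CohTot.{u}) (p : X.Pt) {c : Set X.Token} (hc : c ∈ X.uniCovers) :
    ∃ x ∈ c, x ∈ p.1.1 := by
  obtain ⟨x, hx, hx'⟩ := hc.1.2 _ p.2.1
  exact ⟨x, hx', hx⟩

/-- The entourage `{(a, b) : |a - b| < c}` of the cover `{⟨x⟩° : x ∈ c}`. -/
def entourage (X : CohTot.{u}) (c : Set X.Token) : Set (X.Pt × X.Pt) :=
  {p | ∃ x ∈ c, x ∈ p.1.1.1 ∧ x ∈ p.2.1.1}

/-- The bounded uniformity: the uniformity with the uni-covers as a sub-basis. -/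
@[reducible] def bounded (X : CohTot.{u}) : UniformSpace X.Pt :=
  UniformSpace.ofCore
    { uniformity := ⨅ c ∈ X.uniCovers, Filter.principal (X.entourage c)
      refl := by
        refine le_iInf₂ fun c hc => Filter.principal_mono.2 ?_
        rintro ⟨p, q⟩ h
        obtain rfl : p = q := h
        obtain ⟨x, hx, hx'⟩ := X.uniCover_meets p hc
        exact ⟨x, hx, hx', hx'⟩
      symm := by
        refine Filter.tendsto_iInf.2 fun c => Filter.tendsto_iInf.2 fun hc =>
          Filter.tendsto_principal.2 ?_
        refine Filter.mem_of_superset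
          (Filter.mem_iInf_of_mem c (Filter.mem_iInf_of_mem hc (Filter.mem_principal_self _))) ?_
        rintro ⟨p, q⟩ ⟨x, hx, hp, hq⟩
        exact ⟨x, hx, hq, hp⟩
      comp := by
        refine le_iInf₂ fun c hc => Filter.le_principal_iff.2 ?_
        refine Filter.mem_of_superset (Filter.mem_lift'
          (Filter.mem_iInf_of_mem c (Filter.mem_iInf_of_mem hc (Filter.mem_principal_self _)))) ?_
        rintro ⟨p, q⟩ ⟨r, ⟨x, hx, hp, hr⟩, ⟨y, hy, hr', hq⟩⟩
        have hxy : x = y := eq_of_mem_clique_anticlique r.1.2 hc.1.1 hr hr' hx hy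
        exact ⟨x, hx, hp, hxy ▸ hq⟩ }

/-- The Scott topology restricted to the strict total cliques. -/
@[reducible] def scottPt (X : CohTot.{u}) : TopologicalSpace X.Pt :=
  TopologicalSpace.induced Subtype.val X.toCohSpace.scott

theorem entourage_mem (X : CohTot.{u}) {c : Set X.Token} (hc : c ∈ X.uniCovers) :
    X.entourage c ∈ @uniformity _ X.bounded :=
  Filter.mem_iInf_of_mem c (Filter.mem_iInf_of_mem hc (Filter.mem_principal_self _))

/-- The bounded uniformity is compatible with the Scott topology. -/
theorem bounded_toTopologicalSpace (X : CohTot.{u}) :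
    X.bounded.toTopologicalSpace = X.scottPt := by
  refine TopologicalSpace.ext_nhds fun p => ?_
  have h1 : @nhds X.Pt X.bounded.toTopologicalSpace p =
      ⨅ c ∈ X.uniCovers, Filter.principal {q : X.Pt | (p, q) ∈ X.entourage c} := by
    rw [@nhds_eq_comap_uniformity _ X.bounded p]
    show Filter.comap _ (⨅ c ∈ X.uniCovers, Filter.principal (X.entourage c)) = _
    simp only [Filter.comap_iInf, Filter.comap_principal]
    rfl
  have h2 : @nhds X.Pt X.scottPt p =
      Filter.comap Subtype.val (@nhds X.Clique X.toCohSpace.scott p.1) :=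
    @nhds_induced _ _ X.toCohSpace.scott _ p
  rw [h1, h2, CohSpace.scott, TopologicalSpace.nhds_generateFrom]
  apply le_antisymm
  · simp only [Filter.comap_iInf, Filter.comap_principal]
    refine le_iInf₂ fun U hU => Filter.le_principal_iff.2 ?_
    obtain ⟨hpU, a, ha, rfl⟩ := hU
    have hpa : a.1 ⊆ p.1.1 := hpU
    choose! c hc hxc using fun x (hx : x ∈ a.1) => X.exists_uniCover p (hpa hx)
    have hmem : (⋂ x ∈ a.1, {q : X.Pt | (p, q) ∈ X.entourage (c x)}) ∈
        ⨅ c ∈ X.uniCovers, Filter.principal {q : X.Pt | (p, q) ∈ X.entourage c} :=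
      (Filter.biInter_mem ha).2 fun x hx => Filter.mem_iInf_of_mem (c x)
        (Filter.mem_iInf_of_mem (hc x hx) (Filter.mem_principal_self _))
    refine Filter.mem_of_superset hmem fun q hq x hx => ?_
    obtain ⟨z, hz, hzp, hzq⟩ := Set.mem_iInter₂.1 hq x hx
    have hzx : z = x :=
      eq_of_mem_clique_anticlique p.1.2 (hc x hx).1.1 hzp (hpa hx) hz (hxc x hx)
    exact hzx ▸ hzq
  · refine le_iInf₂ fun c hc => Filter.le_principal_iff.2 ?_
    obtain ⟨x, hx, hxp⟩ := X.uniCover_meets p hc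
    refine ⟨{b | single x ≤ b}, ?_, ?_⟩
    · refine Filter.mem_iInf_of_mem {b | single x ≤ b} (Filter.mem_iInf_of_mem
        ⟨?_, single x, Set.finite_singleton x, rfl⟩ (Filter.mem_principal_self _))
      exact Set.singleton_subset_iff.2 hxp
    · intro q hq
      exact ⟨x, hx, hxp, hq (Set.mem_singleton x)⟩

theorem t2_bounded (X : CohTot.{u}) : @T2Space X.Pt X.bounded.toTopologicalSpace := by
  let _ := X.bounded
  have hle : ∀ p q : X.Pt, Inseparable p q → p.1.1 ⊆ q.1.1 := by
    intro p q h x hx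
    obtain ⟨c, hc, hxc⟩ := X.exists_uniCover p hx
    obtain ⟨z, hz, hzp, hzq⟩ := inseparable_iff_ker_uniformity.1 h _ (X.entourage_mem hc)
    exact (eq_of_mem_clique_anticlique p.1.2 hc.1.1 hx hzp hxc hz) ▸ hzq
  have : T0Space X.Pt := ⟨fun p q h =>
    Subtype.ext (Subtype.ext ((hle p q h).antisymm (hle q p h.symm)))⟩
  infer_instance

theorem t35_scottPt (X : CohTot.{u}) : @T35Space X.Pt X.scottPt := by
  rw [← X.bounded_toTopologicalSpace]
  let _ := X.bounded
  have := X.t2_bounded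
  exact { }

/-- `!X` with the totality `(!T)^⊥⊥`. -/
abbrev bangTot (X : CohTot.{u}) : CohTot.{u} where
  toCohSpace := X.toCohSpace.bang
  totality := X.bang.dual.orth (X.bang.orth (X.bangSet '' X.totality))
  biorth := X.bang.biorth_biorth (by
    rintro _ ⟨a, ha, rfl⟩
    exact X.bangSet_isClique (X.isClique_of_total ha))

theorem bangSet_total (X : CohTot.{u}) {a : Set X.Token} (ha : a ∈ X.totality) :
    X.bangSet a ∈ X.bangTot.totality :=
  X.bang.subset_biorth (by
    rintro _ ⟨a, ha, rfl⟩
    exact X.bangSet_isClique (X.isClique_of_total ha)) ⟨a, ha, rfl⟩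

theorem mem_bang_cototality (X : CohTot.{u}) {c : Set X.bang.Token} (hc : X.bang.dual.IsClique c)
    (h : ∀ a ∈ X.totality, (X.bangSet a ∩ c).Nonempty) : c ∈ X.bangTot.cototality := by
  have hc' : c ∈ X.bang.orth (X.bangSet '' X.totality) := by
    refine ⟨hc, ?_⟩
    rintro _ ⟨a, ha, rfl⟩
    exact h a ha
  refine ⟨hc, fun α hα => ?_⟩
  have := hα.2 c hc'
  rwa [Set.inter_comm] at this

end CohTot

/-- `F` preserves totality. -/
def PreservesTotality {X Y : CohTot.{u}} (F : X.Clique → Y.Clique) : Prop :=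
  ∀ a : X.Clique, a.1 ∈ X.totality → (F a).1 ∈ Y.totality

/-- The transpose of a linear map sends anti-cliques to anti-cliques. -/
theorem transpose_isClique {X Y : CohSpace.{u}} {G : X.Clique → Y.Clique} (hG : IsLinear G)
    {c : Set Y.Token} (hc : Y.dual.IsClique c) :
    X.dual.IsClique {x | ∃ y ∈ c, y ∈ (G (single x)).1} := by
  rintro x ⟨y, hy, hxy⟩ x' ⟨y', hy', hxy'⟩ ⟨hcoh, hne⟩
  obtain ⟨h1, h2⟩ := (isLinear_iff G).1 hG
  have hcl : X.IsClique {x, x'} := by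
    rintro z (rfl | rfl) w (rfl | rfl)
    exacts [X.coh_refl _, hcoh, X.coh_symm _ _ hcoh, X.coh_refl _]
  have hm : y ∈ (G ⟨_, hcl⟩).1 := (h1 _ _).2 ⟨x, Or.inl rfl, hxy⟩
  have hm' : y' ∈ (G ⟨_, hcl⟩).1 := (h1 _ _).2 ⟨x', Or.inr rfl, hxy'⟩
  obtain rfl := eq_of_mem_clique_anticlique (G ⟨_, hcl⟩).2 hc hm hm' hy hy'
  exact hne (h2 ⟨_, hcl⟩ y x (Or.inl rfl) x' (Or.inr rfl) hxy hxy')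

/-- A linear map on `!X` is total as soon as it is total on the cliques `!a`, `a` total. -/
theorem preservesTotality_bang {X Y : CohTot.{u}} {G : X.bangTot.Clique → Y.Clique}
    (hG : IsLinear G)
    (h : ∀ a : X.Clique, a.1 ∈ X.totality → (G (bangClique a)).1 ∈ Y.totality) :
    PreservesTotality G := by
  intro α hα
  rw [CohTot.mem_totality_iff]
  refine ⟨(G α).2, fun c hc => ?_⟩
  have hd : {x | ∃ y ∈ c, y ∈ (G (single x)).1} ∈ X.bangTot.cototality := by
    refine X.mem_bang_cototality (transpose_isClique hG hc.1) fun a ha => ?_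
    obtain ⟨y, hy, hyc⟩ := ((Y.mem_totality_iff _).1
      (h ⟨a, X.isClique_of_total ha⟩ ha)).2 c hc
    obtain ⟨x, hx, hxy⟩ := (((isLinear_iff G).1 hG).1 _ _).1 hy
    exact ⟨x, hx, y, hyc, hxy⟩
  obtain ⟨x, hx, y, hy, hxy⟩ := ((X.bangTot.mem_totality_iff _).1 hα).2 _ hd
  exact ⟨y, (((isLinear_iff G).1 hG).1 _ _).2 ⟨x, hx, hxy⟩, hy⟩

theorem preservesTotality_lift_iff {X Y : CohTot.{u}} {F : X.Clique → Y.Clique}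
    (hF : IsStable F) :
    PreservesTotality (X := X.bangTot) (lift F hF) ↔ PreservesTotality F := by
  constructor
  · intro h a ha
    have := h (bangClique a) (X.bangSet_total ha)
    rwa [lift_bangClique] at this
  · intro h
    refine preservesTotality_bang (isLinear_lift hF) fun a ha => ?_
    rw [lift_bangClique]
    exact h a ha

/-! ### The categories `Lin_Tot` and `Stab_Tot` -/

/-- Total linear maps. -/
@[ext]
structure TotLin (X Y : CohTot.{u}) where
  toFun : X.Clique → Y.Clique
  linear : IsLinear toFun
  total : PreservesTotality toFun

/-- Total stable maps: stable maps whose associated linear map on `!X` is total. -/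
@[ext]
structure TotStab (X Y : CohTot.{u}) where
  toFun : X.Clique → Y.Clique
  stable : IsStable toFun
  total : PreservesTotality (X := X.bangTot) (lift toFun stable)

theorem TotStab.preserves {X Y : CohTot.{u}} (F : TotStab X Y) : PreservesTotality F.toFun :=
  (preservesTotality_lift_iff F.stable).1 F.total

/-- The category of coherence spaces with totality and total linear maps. -/
structure LinTot : Type (u + 1) where
  of ::
  space : CohTot.{u}

/-- The category of coherence spaces with totality and total stable maps. -/
structure StabTot : Type (u + 1) where
  of ::
  space : CohTot.{u}

instance : Category.{u} LinTot.{u} where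
  Hom X Y := TotLin X.space Y.space
  id X := ⟨fun a => a, isLinear_id _, fun _ h => h⟩
  comp F G := ⟨fun a => G.toFun (F.toFun a), G.linear.comp F.linear,
    fun a h => G.total _ (F.total a h)⟩

instance : Category.{u} StabTot.{u} where
  Hom X Y := TotStab X.space Y.space
  id X := ⟨fun a => a, (isLinear_id _).isStable,
    (preservesTotality_lift_iff _).2 fun _ h => h⟩
  comp F G := ⟨fun a => G.toFun (F.toFun a), G.stable.comp F.stable,
    (preservesTotality_lift_iff _).2 fun a h => G.preserves _ (F.preserves a h)⟩

/-! ### The linear–non-linear adjunction -/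

/-- `η_X : X → !X`, `a ↦ !a`, as a total stable map. -/
def etaCoh (X : CohTot.{u}) : TotStab X X.bangTot :=
  ⟨fun a => bangClique a, isStable_bangClique _,
    (preservesTotality_lift_iff _).2 fun _ h => X.bangSet_total h⟩

theorem isLinear_dereliction (Y : CohSpace.{u}) :
    IsLinear (X := Y.bang) (Y := Y)
      (fun α => ⟨{y | (⟨{y}, by simpa using Y.isClique_singleton y⟩ : Y.bang.Token) ∈ α.1},
        fun x hx y hy => α.2 _ hx _ hy x (by simp) y (by simp)⟩) := by
  rintro ι a s ⟨h1, h2⟩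
  refine ⟨?_, fun i j hij => Set.disjoint_left.2 fun y hy hy' =>
    Set.disjoint_left.1 (h2 i j hij) hy hy'⟩
  ext y
  exact (iff_of_eq (congrArg (_ ∈ ·) h1)).trans (by simp only [Set.mem_iUnion, Set.mem_ofPred_eq])

/-- The dereliction `ε_Y : !Y ⊸ Y`, `α ↦ {y | {y} ∈ α}`, as a total linear map. -/
def epsCoh (Y : CohTot.{u}) : TotLin Y.bangTot Y where
  toFun α := ⟨{y | (⟨{y}, by simpa using Y.isClique_singleton y⟩ : Y.bang.Token) ∈ α.1},
    fun x hx y hy => α.2 _ hx _ hy x (by simp) y (by simp)⟩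
  linear := isLinear_dereliction Y.toCohSpace
  total := preservesTotality_bang (isLinear_dereliction Y.toCohSpace) fun a ha => by
    convert ha using 1
    ext y
    simp [bangClique, bangSet]

theorem epsCoh_bangClique (Y : CohTot.{u}) (a : Y.Clique) :
    (epsCoh Y).toFun (bangClique a) = a := by
  refine Subtype.ext (Set.ext fun y => ?_)
  simp [epsCoh, bangClique, bangSet]

/-- `!F : !X ⊸ !Y`, the linear map associated with the stable map `a ↦ !(F a)`. -/
def bangMap {X Y : CohTot.{u}} (F : TotStab X Y) : TotLin X.bangTot Y.bangTot where
  toFun := lift (fun a => bangClique (F.toFun a)) ((isStable_bangClique _).comp F.stable)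
  linear := isLinear_lift _
  total := (preservesTotality_lift_iff _).2 fun a h => Y.bangSet_total (F.preserves a h)

theorem bangMap_bangClique {X Y : CohTot.{u}} (F : TotStab X Y) (a : X.Clique) :
    (bangMap F).toFun (bangClique a) = bangClique (F.toFun a) :=
  lift_bangClique ((isStable_bangClique _).comp F.stable) a

theorem totLin_ext {X Y : CohTot.{u}} {G H : TotLin X.bangTot Y}
    (h : ∀ a : X.Clique, G.toFun (bangClique a) = H.toFun (bangClique a)) : G = H :=
  TotLin.ext (linear_ext G.linear H.linear h)

/-- `K : Stab_Tot ⥤ Lin_Tot`, `X ↦ !X`. -/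
def K : StabTot.{u} ⥤ LinTot.{u} where
  obj X := ⟨X.space.bangTot⟩
  map F := bangMap F
  map_id X := totLin_ext (X := X.space) fun a => bangMap_bangClique (𝟙 X) a
  map_comp {X _ _} F G := totLin_ext (X := X.space) fun a =>
    (bangMap_bangClique (F ≫ G) a).trans
      (((congrArg (bangMap G).toFun (bangMap_bangClique F a)).trans
        (bangMap_bangClique G _)).symm)

/-- `L : Lin_Tot ⥤ Stab_Tot`: the same space, a linear map regarded as a stable map. -/
def L : LinTot.{u} ⥤ StabTot.{u} where
  obj X := ⟨X.space⟩
  map F := ⟨F.toFun, F.linear.isStable, (preservesTotality_lift_iff _).2 F.total⟩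

/-- The linear–non-linear adjunction `K ⊣ L`, with unit `a ↦ !a` and counit the dereliction. -/
def adjKL : K.{u} ⊣ L.{u} := Adjunction.mkOfUnitCounit
  { unit :=
      { app := fun X => etaCoh X.space
        naturality := fun _ _ F => TotStab.ext (funext fun a => (bangMap_bangClique F a).symm) }
    counit :=
      { app := fun Y => epsCoh Y.space
        naturality := fun X Y F => totLin_ext (X := X.space) fun a => by
          show (epsCoh Y.space).toFun ((bangMap (L.map F)).toFun (bangClique a)) =
            F.toFun ((epsCoh X.space).toFun (bangClique a))
          rw [epsCoh_bangClique]
          exact (congrArg (epsCoh Y.space).toFun (bangMap_bangClique (L.map F) a)).trans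
            (epsCoh_bangClique _ _) }
    left_triangle := by
      ext X : 2
      refine totLin_ext (X := X.space) fun a => ?_
      show (epsCoh X.space.bangTot).toFun
        ((𝟙 (K.obj (L.obj (K.obj X))) : TotLin _ _).toFun
          ((bangMap (etaCoh X.space)).toFun (bangClique a))) = bangClique a
      rw [bangMap_bangClique]
      exact epsCoh_bangClique _ _
    right_triangle := by
      ext Y : 2
      exact TotStab.ext (funext fun a => epsCoh_bangClique _ a) }

/-! ### Tychonoff spaces and Hausdorff uniform spaces -/

/-- The property of being a Tychonoff space. -/
def isTychonoff : ObjectProperty TopCat.{u} := fun X => T35Space X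

/-- The category of Tychonoff spaces and continuous maps. -/
abbrev Tych : Type (u + 1) := isTychonoff.{u}.FullSubcategory

/-- The property of being a Hausdorff uniform space. -/
def isHausdorff : ObjectProperty UniformSpaceCat.{u} := fun X => T2Space X

/-- The category of Hausdorff uniform spaces and uniformly continuous maps. -/
abbrev Unif : Type (u + 1) := isHausdorff.{u}.FullSubcategory

/-- The finest uniformity among those compatible with the topology `t` (the order on
`UniformSpace X` is such that finer means smaller). -/
@[reducible] def fine {X : Type u} (t : TopologicalSpace X) : UniformSpace X :=
  sInf {v | v.toTopologicalSpace = t}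

theorem fine_le {X : Type u} {t : TopologicalSpace X} {v : UniformSpace X}
    (h : v.toTopologicalSpace = t) : fine t ≤ v := sInf_le h

theorem fine_toTopologicalSpace {X : Type u} (t : TopologicalSpace X) (h : T35Space X) :
    (fine t).toTopologicalSpace = t := by
  obtain ⟨v, hv⟩ := CompletelyRegularSpace.exists_uniformSpace (X := X)
  refine le_antisymm ((UniformSpace.toTopologicalSpace_mono (fine_le hv)).trans hv.le) ?_
  rw [fine, UniformSpace.toTopologicalSpace_sInf]
  exact le_iInf₂ fun w hw => (show w.toTopologicalSpace = t from hw).ge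

/-- Maps out of a fine space: continuity implies uniform continuity. -/
theorem uniformContinuous_fine {X Y : Type u} (t : TopologicalSpace X) (h : T35Space X)
    (v : UniformSpace Y) {f : X → Y} (hf : Continuous f) :
    @UniformContinuous _ _ (fine t) v f := by
  rw [uniformContinuous_iff_le_comap]
  refine (fine_le (v := fine t ⊓ v.comap f) ?_).trans inf_le_right
  rw [UniformSpace.toTopologicalSpace_inf, fine_toTopologicalSpace t h,
    UniformSpace.toTopologicalSpace_comap]
  exact inf_eq_left.2 (continuous_iff_le_induced.1 hf)

/-- The topologizing functor `G : Unif ⥤ Tych`. -/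
def G : Unif.{u} ⥤ Tych.{u} where
  obj Y := ⟨TopCat.of Y.obj, by
    have : T2Space Y.obj := Y.property
    exact ({ } : T35Space Y.obj)⟩
  map f := ObjectProperty.homMk (TopCat.ofHom ⟨f.hom, f.hom.hom.2.continuous⟩)

/-- The fine functor `F : Tych ⥤ Unif`. -/
def F : Tych.{u} ⥤ Unif.{u} where
  obj X := ⟨@UniformSpaceCat.of X.obj (fine X.obj.str), by
    have h : T35Space X.obj := X.property
    show @T2Space X.obj (fine X.obj.str).toTopologicalSpace
    rw [fine_toTopologicalSpace _ h]
    infer_instance⟩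
  map {X Y} f := ObjectProperty.homMk
    ⟨⟨f.hom, uniformContinuous_fine X.obj.str X.property (fine Y.obj.str) (by
      rw [fine_toTopologicalSpace _ Y.property]
      exact f.hom.hom.continuous)⟩⟩

/-- The adjunction `F ⊣ G`, whose unit and counit are the identity on points. -/
def adjFG : F.{u} ⊣ G.{u} := Adjunction.mkOfUnitCounit
  { unit :=
      { app := fun X => ObjectProperty.homMk (TopCat.ofHom
          (@ContinuousMap.mk X.obj X.obj X.obj.str (fine X.obj.str).toTopologicalSpace id (by
            rw [fine_toTopologicalSpace _ X.property]
            exact continuous_id)))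
        naturality := fun _ _ _ => rfl }
    counit :=
      { app := fun Y => ObjectProperty.homMk
          ⟨⟨id, uniformContinuous_fine _ (G.obj Y).property Y.obj.str continuous_id⟩⟩
        naturality := fun _ _ _ => rfl }
    left_triangle := rfl
    right_triangle := rfl }

/-! ### The functors `I` and `J` -/

/-- The map on strict total cliques induced by a totality preserving map: `a ↦ (F a)°`. -/
def ptMap {X Y : CohTot.{u}} (F : X.Clique → Y.Clique) (hF : PreservesTotality F) (p : X.Pt) :
    Y.Pt := Y.toPt (F p.1) (hF p.1 p.2.1)

theorem ptMap_id (X : CohTot.{u}) (h : PreservesTotality (fun a : X.Clique => a)) (p : X.Pt) :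
    ptMap _ h p = p := X.toPt_eq_iff _ _ _ (Set.Subset.refl _)

theorem ptMap_subset {X Y : CohTot.{u}} (F : X.Clique → Y.Clique) (hF : PreservesTotality F)
    (p : X.Pt) : (ptMap F hF p).1.1 ⊆ (F p.1).1 :=
  fun _ hx => ((Y.mem_strictPart (hF p.1 p.2.1) _).1 hx).1

theorem ptMap_comp {X Y Z : CohTot.{u}} {F : X.Clique → Y.Clique} {G : Y.Clique → Z.Clique}
    (hF : PreservesTotality F) (hG : PreservesTotality G) (hm : Monotone G)
    (h : PreservesTotality (fun a => G (F a))) (p : X.Pt) :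
    ptMap _ h p = ptMap G hG (ptMap F hF p) :=
  Z.toPt_eq_iff _ _ _ ((ptMap_subset G hG _).trans (hm (ptMap_subset F hF p)))

theorem continuous_ptMap {X Y : CohTot.{u}} {F : X.Clique → Y.Clique} (hs : IsStable F)
    (hF : PreservesTotality F) : @Continuous _ _ X.scottPt Y.scottPt (ptMap F hF) := by
  rw [← Y.bounded_toTopologicalSpace]
  let _ := X.scottPt
  let _ := Y.bounded
  rw [continuous_iff_continuousAt]
  intro p
  rw [ContinuousAt, nhds_eq_comap_uniformity, Filter.tendsto_comap_iff]
  refine Filter.tendsto_iInf.2 fun c => Filter.tendsto_iInf.2 fun hc =>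
    Filter.tendsto_principal.2 ?_
  obtain ⟨y, hy, hyp⟩ := Y.uniCover_meets (ptMap F hF p) hc
  obtain ⟨a, hap, hay⟩ := exists_trace hs (ptMap_subset F hF p hyp)
  have hopen : @IsOpen _ X.scottPt {q : X.Pt | (⟨a.1, a.2⟩ : X.Clique) ≤ q.1} :=
    ⟨{b | (⟨a.1, a.2⟩ : X.Clique) ≤ b},
      TopologicalSpace.isOpen_generateFrom_of_mem ⟨_, a.1.finite_toSet, rfl⟩, rfl⟩
  filter_upwards [hopen.mem_nhds (show (⟨a.1, a.2⟩ : X.Clique) ≤ p.1 from hap)] with q hq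
  refine ⟨y, hy, hyp, ?_⟩
  exact (Y.mem_strictPart (hF q.1 q.2.1) y).2 ⟨hs.monotone hq hay.1, c, hc.1, hy⟩

theorem uniformContinuous_ptMap {X Y : CohTot.{u}} {F : X.Clique → Y.Clique} (hl : IsLinear F)
    (hF : PreservesTotality F) :
    @UniformContinuous _ _ X.bounded Y.bounded (ptMap F hF) := by
  refine Filter.tendsto_iInf.2 fun c => Filter.tendsto_iInf.2 fun hc =>
    Filter.tendsto_principal.2 ?_
  obtain ⟨h1, h2⟩ := (isLinear_iff F).1 hl
  have hd : {x | ∃ y ∈ c, y ∈ (F (single x)).1} ∈ X.cototality := by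
    refine ⟨transpose_isClique hl hc.1.1, fun a ha => ?_⟩
    obtain ⟨y, hy, hyc⟩ := ((Y.mem_totality_iff _).1
      (hF ⟨a, X.isClique_of_total ha⟩ ha)).2 c hc.1
    obtain ⟨x, hx, hxy⟩ := (h1 _ _).1 hy
    exact ⟨x, hx, y, hyc, hxy⟩
  refine Filter.mem_of_superset (X.entourage_mem (X.dualTot.strictPart_mem_strict hd)) ?_
  rintro ⟨p, q⟩ ⟨x, hx, hp, hq⟩
  obtain ⟨y, hy, hxy⟩ := ((X.dualTot.mem_strictPart hd x).1 hx).1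
  refine ⟨y, hy, ?_, ?_⟩
  · exact (Y.mem_strictPart (hF p.1 p.2.1) y).2 ⟨(h1 _ _).2 ⟨x, hp, hxy⟩, c, hc.1, hy⟩
  · exact (Y.mem_strictPart (hF q.1 q.2.1) y).2 ⟨(h1 _ _).2 ⟨x, hq, hxy⟩, c, hc.1, hy⟩

/-- `I : Stab_Tot ⥤ Tych`: the strict total cliques with the Scott topology. -/
def I : StabTot.{u} ⥤ Tych.{u} where
  obj X := ⟨@TopCat.of X.space.Pt X.space.scottPt, X.space.t35_scottPt⟩
  map {X Y} F := ObjectProperty.homMk (@TopCat.ofHom _ _ X.space.scottPt Y.space.scottPt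
    (@ContinuousMap.mk _ _ X.space.scottPt Y.space.scottPt (ptMap F.toFun F.preserves)
      (continuous_ptMap F.stable F.preserves)))
  map_id X := by
    apply ObjectProperty.hom_ext
    ext p
    exact ptMap_id X.space (fun _ h => h) p
  map_comp F G := by
    apply ObjectProperty.hom_ext
    ext p
    exact ptMap_comp F.preserves G.preserves G.stable.monotone (F ≫ G).preserves p

/-- `J : Lin_Tot ⥤ Unif`: the strict total cliques with the bounded uniformity. -/
def J : LinTot.{u} ⥤ Unif.{u} where
  obj X := ⟨@UniformSpaceCat.of X.space.Pt X.space.bounded, X.space.t2_bounded⟩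
  map F := ObjectProperty.homMk
    ⟨⟨ptMap F.toFun F.total, uniformContinuous_ptMap F.linear F.total⟩⟩
  map_id X := by
    apply ObjectProperty.hom_ext
    apply UniformSpaceCat.hom_ext
    funext p
    exact ptMap_id X.space (fun _ h => h) p
  map_comp F G := by
    apply ObjectProperty.hom_ext
    apply UniformSpaceCat.hom_ext
    funext p
    exact ptMap_comp F.total G.total G.linear.monotone (F ≫ G).total p

/-! ### Pseudo-maps of adjunctions -/

/-- A pseudo-map of adjunctions from `K ⊣ L` to `F ⊣ G` on the functors `I`, `J`: natural
isomorphisms `J K ≅ F I` and `I L ≅ G J` compatible with the units and the counits. -/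
structure PseudoMapOfAdjunctions {A B C D : Type*} [Category* A] [Category* B] [Category* C]
    [Category* D] {K : A ⥤ B} {L : B ⥤ A} (adj : K ⊣ L) {F : C ⥤ D} {G : D ⥤ C} (adj' : F ⊣ G)
    (I : A ⥤ C) (J : B ⥤ D) where
  left : K ⋙ J ≅ I ⋙ F
  right : L ⋙ I ≅ J ⋙ G
  unit_comp : ∀ X : A, I.map (adj.unit.app X) ≫ right.hom.app (K.obj X) ≫ G.map (left.hom.app X) =
    adj'.unit.app (I.obj X)
  comp_counit : ∀ Y : B, left.hom.app (L.obj Y) ≫ F.map (right.hom.app Y) ≫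
    adj'.counit.app (J.obj Y) = J.map (adj.counit.app Y)

end CohUnif

/-! Everything rests on one identification: the strict total cliques of `!X` with the bounded
uniformity are those of `X` with the fine uniformity. The other isomorphism is the identity on
points, because the bounded uniformity induces the Scott topology.

On points, `α ↦ (ε α)°` and `a ↦ (!a)°` are mutually inverse. A total clique contains exactly one
strict total clique, so two points are equal as soon as one total clique contains both
(`toPt_eq_iff`). For `α` and `(!(ε α)°)°` that clique is `!(⋃ α)`.

The map `a ↦ (!a)°` is continuous, hence uniformly continuous out of a fine space. The converse
carries the weight (`exists_bang_cototality_small`): given an entourage `V` of a compatible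
uniformity, a member of the co-totality of `!X` is needed, each of whose tokens `t` bounds a
`V`-small set of points `{q | t ⊆ q}`. Countability of the tokens gives a sequence of uni-covers
through all tokens that occur in points. Let `U n` be the union of those with index below `n`. A
point `p` meets `U n` in a finite set, and once `n` is large this set contains a finite clique whose
basic neighbourhood is `V`-small. The token attached to `p` is `p ∩ U n` for the least `n` at which
it is small. Two coherent tokens of this kind agree on the smaller level, so minimality gives them
the same level and makes them equal: the tokens form an anti-clique, and every `!a` with `a` total
meets it.

Since the first isomorphism is the dereliction itself on points, the counit law is definitional and
the unit law says that dereliction undoes `a ↦ (!a)°`. -/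

namespace CohUnif

open CohSpace

namespace CohTot

/-! ### The bijection between the points of `!X` and those of `X` -/

/-- The tokens of a clique of `!X`, gathered into a clique of `X`. -/
def bangUnion (X : CohTot.{u}) (α : X.bangTot.Clique) : X.Clique :=
  ⟨{x | ∃ s ∈ α.1, x ∈ s.1}, by
    rintro x ⟨s, hs, hxs⟩ y ⟨t, ht, hyt⟩
    exact α.2 s hs t ht x (Or.inl hxs) y (Or.inr hyt)⟩

theorem subset_bangClique_bangUnion (X : CohTot.{u}) (α : X.bangTot.Clique) :
    α.1 ⊆ (bangClique (X.bangUnion α)).1 :=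
  fun s hs _ hx => ⟨s, hs, hx⟩

theorem epsCoh_subset_bangUnion (X : CohTot.{u}) (α : X.bangTot.Clique) :
    ((epsCoh X).toFun α).1 ⊆ (X.bangUnion α).1 :=
  fun _ hy => ⟨_, hy, by simp⟩

/-- The union contains the dereliction of `α`, which is total, and a clique containing a total
clique is total. -/
theorem bangUnion_total (X : CohTot.{u}) {α : X.bangTot.Clique}
    (hα : α.1 ∈ X.bangTot.totality) : (X.bangUnion α).1 ∈ X.totality := by
  refine (X.mem_totality_iff _).2 ⟨(X.bangUnion α).2, fun c hc => ?_⟩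
  obtain ⟨y, hy, hyc⟩ := ((X.mem_totality_iff _).1 ((epsCoh X).total α hα)).2 c hc
  exact ⟨y, X.epsCoh_subset_bangUnion α hy, hyc⟩

/-- The point `a° ↦ (!a)°` of `!X`. -/
def bangPt (X : CohTot.{u}) : X.Pt → X.bangTot.Pt :=
  ptMap (etaCoh X).toFun (etaCoh X).preserves

/-- The point `α ↦ (ε α)°` of `X`. -/
def derelictPt (X : CohTot.{u}) : X.bangTot.Pt → X.Pt :=
  ptMap (epsCoh X).toFun (epsCoh X).total

theorem derelictPt_bangPt (X : CohTot.{u}) (p : X.Pt) : X.derelictPt (X.bangPt p) = p := by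
  refine (ptMap_comp (etaCoh X).preserves (epsCoh X).total (epsCoh X).linear.monotone
    (fun a h => (epsCoh X).total _ ((etaCoh X).preserves a h)) p).symm.trans ?_
  exact X.toPt_eq_iff _ _ p (epsCoh_bangClique X p.1).ge

/-- Both sides are strict total cliques contained in the total clique `!(⋃ α)`: the left one because
`(ε α)° ⊆ ε α ⊆ ⋃ α`, the right one because each token of `α` is a finite subset of `⋃ α`. -/
theorem bangPt_derelictPt (X : CohTot.{u}) (α : X.bangTot.Pt) :
    X.bangPt (X.derelictPt α) = α := by
  have hb : (X.bangUnion α.1).1 ∈ X.totality := X.bangUnion_total α.2.1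
  have h1 : X.bangTot.toPt (bangClique (X.bangUnion α.1)) (X.bangSet_total hb) = α :=
    X.bangTot.toPt_eq_iff _ _ _ (X.subset_bangClique_bangUnion α.1)
  rw [← h1]
  refine (X.bangTot.toPt_eq_iff _ _ _ ((ptMap_subset _ (etaCoh X).preserves _).trans ?_)).symm
  rw [h1]
  exact (isStable_bangClique _).monotone
    ((ptMap_subset _ (epsCoh X).total α).trans (X.epsCoh_subset_bangUnion α.1))

/-- Since `α = (!p)°` with `p` its dereliction, a token of `α` is a finite subset of `p`. This turns
closeness in `!X` (a shared token) into a shared finite subclique in `X`. -/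
theorem subset_derelictPt (X : CohTot.{u}) {α : X.bangTot.Pt} {s : X.bang.Token}
    (hs : s ∈ α.1.1) : (s.1 : Set X.Token) ⊆ (X.derelictPt α).1.1 := by
  rw [← X.bangPt_derelictPt α] at hs
  exact ptMap_subset _ (etaCoh X).preserves _ hs

/-! ### Small anti-cliques in `!X` -/

/-- A clique meets each anti-clique in at most one token. Uni-covers may be infinite, so this is
what makes the traces of points on finitely many of them tokens of `!X`. -/
theorem finite_inter_iUnion_uniCovers (X : CohTot.{u}) {ι : Type*} {S : Set ι} (hS : S.Finite)
    {C : ι → Set X.Token} (hC : ∀ i ∈ S, C i ∈ X.uniCovers) (p : X.Pt) :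
    (p.1.1 ∩ ⋃ i ∈ S, C i).Finite := by
  rw [Set.inter_iUnion₂]
  exact hS.biUnion fun i hi => Set.Subsingleton.finite fun _ hx _ hy =>
    eq_of_mem_clique_anticlique p.1.2 (hC i hi).1.1 hx.1 hy.1 hx.2 hy.2

/-- Every set of pairs that is a neighbourhood of the diagonal in the sense that each point has a
neighbourhood `⟨s⟩`, `s` a finite clique, whose square it contains, contains the square of every
set `⟨t⟩` for `t` in some member of the co-totality of `!X`. -/
theorem exists_bang_cototality_small (X : CohTot.{u}) (V : Set (X.Pt × X.Pt))
    (hV : ∀ p : X.Pt, ∃ s : Set X.Token, s.Finite ∧ s ⊆ p.1.1 ∧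
      ∀ q r : X.Pt, s ⊆ q.1.1 → s ⊆ r.1.1 → (q, r) ∈ V) :
    ∃ c ∈ X.bangTot.cototality, ∀ t ∈ c, ∀ q r : X.Pt,
      (t.1 : Set X.Token) ⊆ q.1.1 → (t.1 : Set X.Token) ⊆ r.1.1 → (q, r) ∈ V := by
  classical
  have := X.countable_token
  obtain ⟨enc, henc⟩ := exists_injective_nat X.Token
  -- Tokens in no uni-cover can be ignored: none of them belongs to a strict total clique.
  choose! C hC hxC using fun (x : X.Token) (h : ∃ c ∈ X.uniCovers, x ∈ c) => h
  let S : ℕ → Set X.Token := fun n => {x | (∃ c ∈ X.uniCovers, x ∈ c) ∧ enc x < n}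
  let U : ℕ → Set X.Token := fun n => ⋃ x ∈ S n, C x
  have hS : ∀ n, (S n).Finite := fun n =>
    ((Set.finite_lt_nat n).preimage henc.injOn).subset fun x hx => hx.2
  have hSC : ∀ n, ∀ x ∈ S n, C x ∈ X.uniCovers := fun n x hx => hC x hx.1
  have hSmono : ∀ {m n}, m ≤ n → S m ⊆ S n := fun hmn x hx => ⟨hx.1, hx.2.trans_le hmn⟩
  have hUmono : ∀ {m n}, m ≤ n → U m ⊆ U n := fun hmn =>
    Set.biUnion_subset_biUnion_left (hSmono hmn)
  let small : Set X.Token → Prop := fun t =>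
    ∀ q r : X.Pt, t ⊆ q.1.1 → t ⊆ r.1.1 → (q, r) ∈ V
  -- `t` looks like the trace of a point on `U n`: it lies in `U n` and meets each cover of that
  -- level. The last clause makes `n` the first level at which the trace is small.
  let P : ℕ → X.bang.Token → Prop := fun n t => small t.1 ∧ (t.1 : Set X.Token) ⊆ U n ∧
    (∀ x ∈ S n, ((t.1 : Set X.Token) ∩ C x).Nonempty) ∧
    ∀ m < n, ¬ small ((t.1 : Set X.Token) ∩ U m)
  have unique : ∀ {n n' t t'}, n ≤ n' → P n t → P n' t' → X.bang.coh t t' → t = t' := by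
    intro n n' t t' hn ht ht' hcoh
    -- Both tokens meet every cover of level `n`, and their union is a clique, so they meet each
    -- such cover in the same token.
    have h : (t'.1 : Set X.Token) ∩ U n = t.1 := by
      refine Set.Subset.antisymm ?_ fun z hz => ?_
      · rintro z ⟨hz, hzU⟩
        obtain ⟨x, hx, hzx⟩ := Set.mem_iUnion₂.1 hzU
        obtain ⟨w, hw, hwx⟩ := ht.2.2.1 x hx
        exact eq_of_mem_clique_anticlique hcoh (hSC n x hx).1.1 (Or.inr hz) (Or.inl hw) hzx hwx ▸ hw
      · obtain ⟨x, hx, hzx⟩ := Set.mem_iUnion₂.1 (ht.2.1 hz)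
        obtain ⟨w, hw, hwx⟩ := ht'.2.2.1 x (hSmono hn hx)
        refine ⟨?_, ht.2.1 hz⟩
        exact eq_of_mem_clique_anticlique hcoh (hSC n x hx).1.1 (Or.inl hz) (Or.inr hw) hzx hwx ▸ hw
    -- If `n < n'`, the trace of `t'` on `U n` would be `t`, which is small, against the minimality
    -- of `n'`.
    have hnn : n = n' := by
      by_contra hne
      exact ht'.2.2.2 n (lt_of_le_of_ne hn hne) (h.symm ▸ ht.1)
    subst hnn
    rw [Set.inter_eq_left.2 ht'.2.1] at h
    exact Subtype.ext (Finset.coe_injective h.symm)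
  refine ⟨{t | ∃ n, P n t}, X.mem_bang_cototality ?_ ?_, fun t ⟨_, ht⟩ => ht.1⟩
  · rintro t ⟨n, ht⟩ t' ⟨n', ht'⟩ ⟨hcoh, hne⟩
    rcases le_total n n' with h | h
    · exact hne (unique h ht ht' hcoh)
    · exact hne (unique h ht' ht (X.bang.coh_symm _ _ hcoh)).symm
  · intro a ha
    let p : X.Pt := X.toPt ⟨a, X.isClique_of_total ha⟩ ha
    have hpa : p.1.1 ⊆ a := fun x hx => ((X.mem_strictPart ha x).1 hx).1
    obtain ⟨s, hs, hsp, hsV⟩ := hV p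
    -- Smallness passes to larger sets, so it is enough that the trace contains `s`. Each `x ∈ s`
    -- lies in its own cover `C x`; as `S n` asks for codes strictly below `n`, the level is one
    -- more than a bound on the codes of `s`.
    have hex : ∃ n, small (p.1.1 ∩ U n) := by
      obtain ⟨N, hN⟩ := (hs.image enc).bddAbove
      refine ⟨N + 1, fun q r hq hr => ?_⟩
      have hsub : s ⊆ p.1.1 ∩ U (N + 1) := fun x hx =>
        ⟨hsp hx, Set.mem_biUnion (show x ∈ S (N + 1) from
          ⟨X.exists_uniCover p (hsp hx), Nat.lt_succ_of_le (hN ⟨x, hx, rfl⟩)⟩)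
          (hxC x (X.exists_uniCover p (hsp hx)))⟩
      exact hsV q r (hsub.trans hq) (hsub.trans hr)
    have hfin := X.finite_inter_iUnion_uniCovers (hS (Nat.find hex)) (hSC _) p
    have hcl : X.IsClique (hfin.toFinset : Set X.Token) :=
      p.1.2.mono (by rw [hfin.coe_toFinset]; exact Set.inter_subset_left)
    refine ⟨⟨hfin.toFinset, hcl⟩, ?_, Nat.find hex, ?_⟩
    · show (hfin.toFinset : Set X.Token) ⊆ a
      rw [hfin.coe_toFinset]
      exact Set.inter_subset_left.trans hpa
    · simp only [P, hfin.coe_toFinset]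
      refine ⟨Nat.find_spec hex, Set.inter_subset_right, fun x hx => ?_, fun m hm => ?_⟩
      · obtain ⟨z, hz, hzp⟩ := X.uniCover_meets p (hSC _ x hx)
        exact ⟨z, ⟨hzp, Set.mem_biUnion hx hz⟩, hz⟩
      -- For `m` below the level chosen, cutting the token down to `U m` gives `p ∩ U m`, which is
      -- not small by minimality.
      · have := Nat.find_min hex hm
        rwa [Set.inter_assoc, Set.inter_eq_right.2 (hUmono hm.le)]

/-! ### Fineness of the bounded uniformity on `!X` -/

/-- In the Scott topology, every neighbourhood of `p` contains some `⟨s⟩`, `s ⊆ p` finite. -/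
theorem exists_finite_of_mem_nhds (X : CohTot.{u}) {p : X.Pt} {W : Set X.Pt}
    (hW : W ∈ @nhds _ X.scottPt p) :
    ∃ s : Set X.Token, s.Finite ∧ s ⊆ p.1.1 ∧ ∀ q : X.Pt, s ⊆ q.1.1 → q ∈ W := by
  obtain ⟨W', hW', hsub⟩ := (@mem_nhds_induced _ _ X.toCohSpace.scott Subtype.val p W).1 hW
  suffices h : ∃ s : Set X.Token, s.Finite ∧ s ⊆ p.1.1 ∧
      ∀ b : X.Clique, s ⊆ b.1 → b ∈ W' by
    obtain ⟨s, hs, hsp, h⟩ := h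
    exact ⟨s, hs, hsp, fun q hq => hsub (h q.1 hq)⟩
  obtain ⟨O, hOW, hO, hpO⟩ := (@mem_nhds_iff _ X.toCohSpace.scott _ _).1 hW'
  suffices h : ∃ s : Set X.Token, s.Finite ∧ s ⊆ p.1.1 ∧ ∀ b : X.Clique, s ⊆ b.1 → b ∈ O by
    obtain ⟨s, hs, hsp, h⟩ := h
    exact ⟨s, hs, hsp, fun b hb => hOW (h b hb)⟩
  clear hOW
  induction hO with
  | basic U hU =>
    obtain ⟨a, ha, rfl⟩ := hU
    exact ⟨a.1, ha, hpO, fun b hb => hb⟩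
  | univ => exact ⟨∅, Set.finite_empty, Set.empty_subset _, fun _ _ => trivial⟩
  | inter U U' _ _ ih ih' =>
    obtain ⟨s, hs, hsp, h⟩ := ih hpO.1
    obtain ⟨s', hs', hsp', h'⟩ := ih' hpO.2
    exact ⟨s ∪ s', hs.union hs', Set.union_subset hsp hsp', fun b hb =>
      ⟨h b (Set.subset_union_left.trans hb), h' b (Set.subset_union_right.trans hb)⟩⟩
  | sUnion T _ ih =>
    obtain ⟨U, hU, hpU⟩ := hpO
    obtain ⟨s, hs, hsp, h⟩ := ih U hU hpU
    exact ⟨s, hs, hsp, fun b hb => ⟨U, hU, h b hb⟩⟩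

/-- The bounded uniformity of `!X` is finer than every uniformity compatible with the Scott
topology of `X`. -/
theorem uniformContinuous_derelictPt (X : CohTot.{u}) (v : UniformSpace X.Pt)
    (hv : v.toTopologicalSpace = X.scottPt) :
    @UniformContinuous _ _ X.bangTot.bounded v X.derelictPt := by
  intro V hV
  -- Two points in the `W`-ball of `p` are then `V`-close through `p`, so a basic Scott
  -- neighbourhood inside that ball has its square in `V`.
  obtain ⟨W, hW, hWsymm, hWV⟩ := @comp_symm_mem_uniformity_sets _ v V hV
  obtain ⟨c, hc, hcV⟩ := X.exists_bang_cototality_small V fun p => by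
    have hn := @UniformSpace.ball_mem_nhds _ v p W hW
    rw [hv] at hn
    obtain ⟨s, hs, hsp, h⟩ := X.exists_finite_of_mem_nhds hn
    exact ⟨s, hs, hsp, fun q r hq hr => hWV ⟨p, hWsymm.symm _ _ (h q hq), h r hr⟩⟩
  -- The anti-clique found need not be strict. Its strict part is a uni-cover, and being a subset it
  -- still has only small tokens.
  refine Filter.mem_map.2 <| Filter.mem_of_superset
    (X.bangTot.entourage_mem (X.bangTot.dualTot.strictPart_mem_strict hc)) ?_
  rintro ⟨α, β⟩ ⟨t, ht, hα, hβ⟩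
  exact hcV t ((X.bangTot.dualTot.mem_strictPart hc t).1 ht).1 _ _
    (X.subset_derelictPt hα) (X.subset_derelictPt hβ)

end CohTot

/-! ### The two natural isomorphisms -/

/-- `J K X ≅ F I X`: the strict total cliques of `!X` with the bounded uniformity are those of `X`
with the fine uniformity. -/
def boundedBangIso (X : StabTot.{u}) : (K ⋙ J).obj X ≅ (I ⋙ F).obj X where
  hom := ObjectProperty.homMk ⟨⟨X.space.derelictPt, X.space.uniformContinuous_derelictPt
    (fine X.space.scottPt) (fine_toTopologicalSpace _ X.space.t35_scottPt)⟩⟩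
  inv := ObjectProperty.homMk ⟨⟨X.space.bangPt,
    uniformContinuous_fine X.space.scottPt X.space.t35_scottPt X.space.bangTot.bounded (by
      rw [X.space.bangTot.bounded_toTopologicalSpace]
      exact continuous_ptMap (etaCoh X.space).stable (etaCoh X.space).preserves)⟩⟩
  hom_inv_id := by
    apply ObjectProperty.hom_ext
    apply UniformSpaceCat.hom_ext
    funext α
    exact X.space.bangPt_derelictPt α
  inv_hom_id := by
    apply ObjectProperty.hom_ext
    apply UniformSpaceCat.hom_ext
    funext p
    exact X.space.derelictPt_bangPt p

/-- Naturality of `J K ≅ F I`. It may be checked on `α = (!p)°`, whose image under `!f` is `(!(f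
p)°)°`, because both are strict total cliques inside the total clique `!(f p)`. -/
theorem derelictPt_ptMap_bangMap {X Y : CohTot.{u}} (f : TotStab X Y) (α : X.bangTot.Pt) :
    Y.derelictPt (ptMap (bangMap f).toFun (bangMap f).total α) =
      ptMap f.toFun f.preserves (X.derelictPt α) := by
  obtain ⟨p, rfl⟩ : ∃ p, α = X.bangPt p := ⟨_, (X.bangPt_derelictPt α).symm⟩
  rw [X.derelictPt_bangPt]
  have h : ptMap (bangMap f).toFun (bangMap f).total (X.bangPt p) =
      Y.bangPt (ptMap f.toFun f.preserves p) := by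
    have h1 := Y.bangTot.toPt_eq_iff (bangClique (f.toFun p.1))
      (Y.bangSet_total (f.preserves p.1 p.2.1))
    refine (h1 _ ?_).symm.trans (h1 _ ?_)
    · refine ((ptMap_subset _ (bangMap f).total _).trans ((bangMap f).linear.monotone
        (ptMap_subset _ (etaCoh X).preserves p))).trans ?_
      exact (bangMap_bangClique f p.1).le
    · exact (ptMap_subset _ (etaCoh Y).preserves _).trans
        ((isStable_bangClique _).monotone (ptMap_subset _ f.preserves p))
  rw [h, Y.derelictPt_bangPt]

/-- `I L Y ≅ G J Y`: the bounded uniformity induces the Scott topology. -/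
def scottIso (Y : LinTot.{u}) : (L ⋙ I).obj Y ≅ (J ⋙ G).obj Y where
  hom := ObjectProperty.homMk (@TopCat.ofHom _ _ Y.space.scottPt Y.space.bounded.toTopologicalSpace
    (@ContinuousMap.mk _ _ Y.space.scottPt Y.space.bounded.toTopologicalSpace id
      (continuous_id_iff_le.2 Y.space.bounded_toTopologicalSpace.ge)))
  inv := ObjectProperty.homMk (@TopCat.ofHom _ _ Y.space.bounded.toTopologicalSpace Y.space.scottPt
    (@ContinuousMap.mk _ _ Y.space.bounded.toTopologicalSpace Y.space.scottPt id
      (continuous_id_iff_le.2 Y.space.bounded_toTopologicalSpace.le)))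
  hom_inv_id := rfl
  inv_hom_id := rfl

end CohUnif

/-! ### Compatibility with units and counits -/

theorem mainTheorem11 :
    Nonempty (CohUnif.PseudoMapOfAdjunctions CohUnif.adjKL.{u} CohUnif.adjFG.{u}
      CohUnif.I.{u} CohUnif.J.{u}) := by
  refine ⟨⟨NatIso.ofComponents CohUnif.boundedBangIso fun {X Y} f => ?_,
    NatIso.ofComponents CohUnif.scottIso fun {X Y} f => rfl, fun X => ?_, fun Y => ?_⟩⟩
  · apply ObjectProperty.hom_ext
    apply UniformSpaceCat.hom_ext
    funext α
    exact CohUnif.derelictPt_ptMap_bangMap f α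
  · apply ObjectProperty.hom_ext
    ext p
    exact X.space.derelictPt_bangPt p
  -- Both the comparison `I L ≅ G J` and the counit of `F ⊣ G` are the identity on points, and what
  -- remains is `α ↦ (ε α)°` on both sides.
  · apply ObjectProperty.hom_ext
    apply UniformSpaceCat.hom_ext
    funext α
    rfl
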